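/- **Polynomial Hales–Jewett theorem.** For all positive integers $r, d, q$ there exists a positive integer $N = N(r,d,q)$ such that, with $V = \{1,\dots,N\}^d \times \{1,\dots,q\}$, the following holds: for every $r$-coloring of the set of all subsets of $V$, i.e. every map $\chi$ from the set of all subsets of $V$ (including $\emptyset$) to $\{1,\dots,r\}$, there exist a set $a \subseteq V$ and a nonempty set $\gamma \subseteq \{1,\dots,N\}$ such that $a \cap (\gamma^d \times \{1,\dots,q\}) = \emptyset$ and the sets $$a,\quad a \cup (\gamma^d \times \{1\}),\quad a \cup (\gamma^d \times \{2\}),\quad \dots,\quad a \cup (\gamma^d \times \{q\})$$ all have the same color, i.e. $\chi(a \cup (\gamma^d \times \{i\})) = \chi(a)$ for every $i \in \{1,\dots,q\}$. Here $\gamma^d \subseteq \{1,\dots,N\}^d$ is the $d$-fold Cartesian power of $\gamma$. -/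

import Mathlib

/-- The ground set `V = {1, …, N}^d × {1, …, q}`, with `Fin n` as the `n`-element index set. -/
abbrev PHJSpace (N d q : ℕ) : Type := (Fin d → Fin N) × Fin q

/-- The Cartesian power `γ^d ⊆ {1, …, N}^d` of a set `γ ⊆ {1, …, N}`. -/
def cartesianPower {N : ℕ} (d : ℕ) (γ : Finset (Fin N)) : Finset (Fin d → Fin N) :=
  Fintype.piFinset fun _ => γ

/-! Colour focusing plus a PET-style induction. Over `ι₁ ⊕ ι₂`, evaluating the coordinates lying in
`ι₁` turns the points not wholly over `ι₁` into points over `ι₂` with new labels. If the resulting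
`focusFamily` is Ramsey for every finite `ι₁`, focused configurations in more and more colours can
be built until the colours run out (`isRamsey_of_focusFamily`). The induction terminates when `c` is
chosen closest in degree to `q`, say differing in degree `m`. Relative to `liftLabels q c ∅`, the
new family has no more leading parts in degrees above `m` and strictly fewer in degree `m`
(`leadingParts_focusFamily_subset`); growth in lower degrees is harmless lexicographically. -/

namespace PolyHalesJewett

open Set

/-- Points over the ground set `ι`: a label `k` with an `ι`-valued tuple indexed by the
coordinates of `k`. -/
abbrev Point {K : Type} (C : K → Type) (ι : Type) : Type := Σ k : K, C k → ι

/-- The set `a` with its trace on `⋃ k, γ ^ C k` replaced by `⋃ k ∈ L, γ ^ C k`. -/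
def override {K : Type} {C : K → Type} {ι : Type} (a : Set (Point C ι)) (γ : Set ι) (L : Set K) :
    Set (Point C ι) :=
  {v | ((∀ c, v.2 c ∈ γ) ∧ v.1 ∈ L) ∨ ((¬ ∀ c, v.2 c ∈ γ) ∧ v ∈ a)}

/-- Every finite colouring of the sets of points over some finite ground set is constant on
`{override a γ L | L ∈ 𝓛}` for some `a` and some nonempty `γ`. -/
def IsRamsey {K : Type} (C : K → Type) (𝓛 : Set (Set K)) : Prop :=
  ∀ (κ : Type) [Finite κ], ∃ (ι : Type) (_ : Finite ι), ∀ χ : Set (Point C ι) → κ,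
    ∃ (a : Set (Point C ι)) (γ : Set ι), γ.Nonempty ∧
      ∀ L ∈ 𝓛, ∀ L' ∈ 𝓛, χ (override a γ L) = χ (override a γ L')

/-- Labels whose coordinates are partially evaluated in `ι`, at least one remaining free. -/
abbrev PartialLabel {K : Type} (C : K → Type) (ι : Type) : Type :=
  Σ k : K, {z : C k → Option ι // ∃ c, z c = none}

/-- The free coordinates of a partially evaluated label. -/
abbrev FreeCoord {K : Type} (C : K → Type) (ι : Type) (k : PartialLabel C ι) : Type :=
  {c : C k.1 // k.2.1 c = none}

/-! ### Splitting the ground set -/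

section Combine

variable {K : Type} {C : K → Type} {ι₁ ι₂ : Type}

open Classical in
/-- The set of points over `ι₁ ⊕ ι₂` that is `x` on the points with all coordinates in `ι₁` and
`y` on the remaining points, which are points over `ι₂` with a partially evaluated label. -/
def combine (x : Set (Point C ι₁)) (y : Set (Point (FreeCoord C ι₁) ι₂)) :
    Set (Point C (ι₁ ⊕ ι₂)) :=
  {v | if h : ∃ c, (v.2 c).getLeft? = none then
      (⟨⟨v.1, fun c => (v.2 c).getLeft?, h⟩, fun c => (v.2 c.1).getRight
        (Sum.getLeft?_eq_none_iff.1 c.2)⟩ : Point (FreeCoord C ι₁) ι₂) ∈ y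
    else (⟨v.1, fun c => (v.2 c).getLeft (by
        by_contra hc
        exact h ⟨c, by simpa using hc⟩)⟩ : Point C ι₁) ∈ x}

/-- The label set which agrees with `L` on partial evaluations in `δ` and with `q` elsewhere. -/
def liftLabels (q L : Set K) (δ : Set ι₁) : Set (PartialLabel C ι₁) :=
  {k | ((∀ c y, k.2.1 c = some y → y ∈ δ) ∧ k.1 ∈ L) ∨
    ((¬ ∀ c y, k.2.1 c = some y → y ∈ δ) ∧ k.1 ∈ q)}

theorem liftLabels_self (q : Set K) (δ : Set ι₁) :
    (liftLabels q q δ : Set (PartialLabel C ι₁)) = {k | k.1 ∈ q} := by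
  ext k
  simp only [liftLabels, mem_ofPred_eq]
  tauto

theorem override_empty [∀ k, Nonempty (C k)] (a : Set (Point C ι₁)) (L : Set K) :
    override a ∅ L = a := by
  ext v
  simp [override]

theorem exists_eq_inl {D : Type} {p : D → ι₁ ⊕ ι₂} (h : ¬ ∃ c, (p c).getLeft? = none) :
    ∃ p' : D → ι₁, p = fun c => Sum.inl (p' c) := by
  push Not at h
  choose p' hp' using fun c => Option.ne_none_iff_exists'.1 (h c)
  exact ⟨p', funext fun c => Sum.getLeft?_eq_some_iff.1 (hp' c)⟩

theorem override_combine_inl (x : Set (Point C ι₁)) (y : Set (Point (FreeCoord C ι₁) ι₂))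
    (γ : Set ι₁) (L : Set K) :
    override (combine x y) (Sum.inl '' γ) L = combine (override x γ L) y := by
  ext ⟨k, p⟩
  by_cases h : ∃ c, (p c).getLeft? = none
  · have h' : ¬ ∀ c, p c ∈ (Sum.inl '' γ : Set (ι₁ ⊕ ι₂)) := by
      obtain ⟨c, hc⟩ := h
      intro H
      obtain ⟨u, -, hu⟩ := H c
      simp [← hu] at hc
    simp only [override, combine, mem_ofPred_eq, h', h, dif_pos, false_and, not_false_eq_true,
      true_and, false_or]
  · obtain ⟨p', rfl⟩ := exists_eq_inl h
    simp [override, combine, -mem_image, Sum.inl_injective.mem_set_image]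

/-- A tuple not wholly over `ι₁` lies in the union iff its evaluated coordinates lie in `γ₁` and its
free ones in `γ₂`. If only the latter holds, the inner override leaves the trace of `q`. -/
theorem override_combine_union (x : Set (Point C ι₁)) (y : Set (Point (FreeCoord C ι₁) ι₂))
    (γ₁ : Set ι₁) (γ₂ : Set ι₂) (q L : Set K) :
    override (combine x (override y γ₂ {k | k.1 ∈ q})) (Sum.inl '' γ₁ ∪ Sum.inr '' γ₂) L =
      combine (override x γ₁ L) (override y γ₂ (liftLabels q L γ₁)) := by
  ext ⟨k, p⟩
  by_cases h : ∃ c, (p c).getLeft? = none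
  · have key : (∀ c, p c ∈ (Sum.inl '' γ₁ ∪ Sum.inr '' γ₂ : Set (ι₁ ⊕ ι₂))) ↔
        (∀ c u, (p c).getLeft? = some u → u ∈ γ₁) ∧
        (∀ c : {c // (p c).getLeft? = none},
          (p c.1).getRight (Sum.getLeft?_eq_none_iff.1 c.2) ∈ γ₂) := by
      constructor
      · intro H
        refine ⟨fun c u hu => ?_, fun ⟨c, hc⟩ => ?_⟩
        · have := H c
          rw [Sum.getLeft?_eq_some_iff.1 hu] at this
          simpa using this
        · have := H c
          obtain ⟨u, hu⟩ := Sum.isRight_iff.1 (Sum.getLeft?_eq_none_iff.1 hc)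
          simpa [hu] using this
      · rintro ⟨H₁, H₂⟩ c
        rcases hc : p c with u | u
        · have := H₁ c u (by simp [hc])
          simpa using this
        · have := H₂ ⟨c, by simp [hc]⟩
          simpa [hc] using this
    simp only [override, combine, liftLabels, mem_ofPred_eq, h, dif_pos, key]
    tauto
  · obtain ⟨p', rfl⟩ := exists_eq_inl h
    have hr (u : ι₁) : (Sum.inl u : ι₁ ⊕ ι₂) ∉ Sum.inr '' γ₂ := by simp
    simp [override, combine, -mem_image, Sum.inl_injective.mem_set_image, hr]

end Combine

/-- The family of label sets that has to be treated when colour focusing `𝓛` at `q`. -/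
def focusFamily {K : Type} (C : K → Type) (𝓛 : Set (Set K)) (q : Set K) (ι : Type) :
    Set (Set (PartialLabel C ι)) :=
  {M | ∃ L ∈ 𝓛, L ≠ q ∧ ∃ δ : Set ι, M = liftLabels q L δ}

/-! ### Colour focusing -/

section Focusing

variable {K : Type} {C : K → Type} [Finite K] [∀ k, Finite (C k)] [∀ k, Nonempty (C k)]

/-- Colour focusing: there is either a monochromatic configuration, or there are `s`
configurations in distinct colours, monochromatic up to the label set `q`, where they agree. -/
theorem exists_mono_or_focused {𝓛 : Set (Set K)} {q c : Set K} (hc : c ∈ 𝓛) (hcq : c ≠ q)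
    (h : ∀ (ι : Type) [Finite ι], IsRamsey (FreeCoord C ι) (focusFamily C 𝓛 q ι))
    (κ : Type) [Finite κ] (s : ℕ) :
    ∃ (ι : Type) (_ : Finite ι), ∀ χ : Set (Point C ι) → κ,
      (∃ (a : Set (Point C ι)) (γ : Set ι), γ.Nonempty ∧
        ∀ L ∈ 𝓛, ∀ L' ∈ 𝓛, χ (override a γ L) = χ (override a γ L')) ∨
      ∃ (f : Set (Point C ι)) (T : Finset κ), T.card = s ∧ ∀ t ∈ T,
        ∃ (a : Set (Point C ι)) (γ : Set ι), γ.Nonempty ∧ override a γ q = f ∧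
          ∀ L ∈ 𝓛, L ≠ q → χ (override a γ L) = t := by
  classical
  induction s with
  | zero => exact ⟨Unit, inferInstance, fun χ => Or.inr ⟨∅, ∅, rfl, by simp⟩⟩
  | succ s ih =>
    obtain ⟨ι₁, _, h₁⟩ := ih
    -- The colour of `y` is the whole function `x ↦ χ (combine x y)`, so the choice of `y` and `γ`
    -- serves all `x` at once.
    obtain ⟨ι₂, _, h₂⟩ := h ι₁ (Set (Point C ι₁) → κ)
    refine ⟨ι₁ ⊕ ι₂, inferInstance, fun χ => ?_⟩
    obtain ⟨y, γ, hγ, hy⟩ := h₂ fun y x => χ (combine x y)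
    set y₀ := override y γ (liftLabels q c ∅) with hy₀
    have hχ (L) (hL : L ∈ 𝓛) (hLq : L ≠ q) (δ : Set ι₁) (x) :
        χ (combine x (override y γ (liftLabels q L δ))) = χ (combine x y₀) :=
      congrFun (hy _ ⟨L, hL, hLq, δ, rfl⟩ _ ⟨c, hc, hcq, ∅, rfl⟩) x
    rcases h₁ fun x => χ (combine x y₀) with ⟨a, γ₁, hγ₁, ha⟩ | ⟨f, T, hT, hf⟩
    · refine Or.inl ⟨combine a y₀, Sum.inl '' γ₁, hγ₁.image _, fun L hL L' hL' => ?_⟩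
      simpa only [override_combine_inl] using ha L hL L' hL'
    by_cases hfT : χ (combine f y₀) ∈ T
    · obtain ⟨a, γ₁, hγ₁, haf, ha⟩ := hf _ hfT
      have key : ∀ L ∈ 𝓛, χ (combine (override a γ₁ L) y₀) = χ (combine f y₀) := by
        intro L hL
        by_cases hLq : L = q
        · rw [hLq, haf]
        · exact ha L hL hLq
      refine Or.inl ⟨combine a y₀, Sum.inl '' γ₁, hγ₁.image _, fun L hL L' hL' => ?_⟩
      rw [override_combine_inl, override_combine_inl, key L hL, key L' hL']
    · refine Or.inr ⟨combine f (override y γ {k | k.1 ∈ q}), insert (χ (combine f y₀)) T,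
        by rw [Finset.card_insert_of_notMem hfT, hT], fun t ht => ?_⟩
      have main : ∃ (a : Set (Point C ι₁)) (γ₁ : Set ι₁), override a γ₁ q = f ∧
          ∀ L ∈ 𝓛, L ≠ q → χ (combine (override a γ₁ L) y₀) = t := by
        rcases Finset.mem_insert.1 ht with rfl | ht
        -- The new colour comes from the focus itself, moving only the `ι₂` part.
        · exact ⟨f, ∅, override_empty _ _, fun L _ _ => by rw [override_empty]⟩
        · obtain ⟨a, γ₁, -, haf, ha⟩ := hf t ht
          exact ⟨a, γ₁, haf, ha⟩
      obtain ⟨a, γ₁, haf, ha⟩ := main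
      refine ⟨combine a (override y γ {k | k.1 ∈ q}), Sum.inl '' γ₁ ∪ Sum.inr '' γ,
        (hγ.image _).inr, ?_, fun L hL hLq => ?_⟩
      · rw [override_combine_union, liftLabels_self, haf]
      · rw [override_combine_union, hχ L hL hLq, ha L hL hLq]

theorem isRamsey_of_focusFamily {𝓛 : Set (Set K)} {q c : Set K} (hc : c ∈ 𝓛) (hcq : c ≠ q)
    (h : ∀ (ι : Type) [Finite ι], IsRamsey (FreeCoord C ι) (focusFamily C 𝓛 q ι)) :
    IsRamsey C 𝓛 := by
  intro κ _
  obtain ⟨ι, hι, H⟩ := exists_mono_or_focused hc hcq h κ (Nat.card κ + 1)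
  refine ⟨ι, hι, fun χ => (H χ).resolve_right ?_⟩
  rintro ⟨-, T, hT, -⟩
  have := Fintype.ofFinite κ
  have := T.card_le_univ
  rw [Nat.card_eq_fintype_card] at hT
  omega

end Focusing

/-! ### Leading parts and their decrease -/

section Weight

variable {K : Type} (C : K → Type)

/-- `e` is the largest number of coordinates of a label on which `L` and `M` differ. -/
def DiffAt (L M : Set K) (e : ℕ) : Prop :=
  (∀ k, e < Nat.card (C k) → (k ∈ L ↔ k ∈ M)) ∧ ∃ k, Nat.card (C k) = e ∧ ¬ (k ∈ L ↔ k ∈ M)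

/-- The labels of `L` with exactly `e` coordinates. -/
def degreePart (L : Set K) (e : ℕ) : Set K := {k ∈ L | Nat.card (C k) = e}

/-- The leading parts of degree `e` of the members of `𝓛`, relative to `q`. -/
def leadingParts (𝓛 : Set (Set K)) (q : Set K) (e : ℕ) : Set (Set K) :=
  (degreePart C · e) '' {L ∈ 𝓛 | DiffAt C L q e}

variable {C}

theorem DiffAt.le {L M : Set K} {e e' : ℕ} (h : DiffAt C L M e)
    (h' : ∀ k, e' < Nat.card (C k) → (k ∈ L ↔ k ∈ M)) : e ≤ e' := by
  obtain ⟨-, k, rfl, hk⟩ := h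
  exact not_lt.1 fun hlt => hk (h' k hlt)

theorem DiffAt.ne {L M : Set K} {e : ℕ} (h : DiffAt C L M e) : L ≠ M := by
  rintro rfl
  obtain ⟨-, k, -, hk⟩ := h
  exact hk Iff.rfl

theorem exists_diffAt [Finite K] {L M : Set K} (h : L ≠ M) : ∃ e, DiffAt C L M e := by
  have hne : {k | ¬ (k ∈ L ↔ k ∈ M)}.Nonempty := by
    by_contra hcon
    rw [not_nonempty_iff_eq_empty, eq_empty_iff_forall_notMem] at hcon
    exact h (Set.ext fun k => not_not.1 (hcon k))
  obtain ⟨k, hk, hmax⟩ := Set.exists_max_image _ (fun k => Nat.card (C k)) (toFinite _) hne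
  exact ⟨_, fun k' hk' => not_not.1 fun hcon => (hmax k' hcon).not_gt hk', k, rfl, hk⟩

variable {ι : Type}

theorem card_freeCoord_le [∀ k, Finite (C k)] (k : PartialLabel C ι) :
    Nat.card (FreeCoord C ι k) ≤ Nat.card (C k.1) :=
  Finite.card_subtype_le _

theorem eq_none_of_card_eq [∀ k, Finite (C k)] {k : PartialLabel C ι}
    (h : Nat.card (FreeCoord C ι k) = Nat.card (C k.1)) (c : C k.1) : k.2.1 c = none := by
  by_contra hc
  exact (Finite.card_subtype_lt (p := fun c => k.2.1 c = none) hc).ne h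

theorem mem_liftLabels_of_free {q L : Set K} {δ : Set ι} {k : PartialLabel C ι}
    (h : ∀ c, k.2.1 c = none) : k ∈ liftLabels q L δ ↔ k.1 ∈ L := by
  simp [liftLabels, h]

theorem mem_liftLabels_of_iff {q L : Set K} {δ : Set ι} {k : PartialLabel C ι}
    (h : k.1 ∈ L ↔ k.1 ∈ q) : k ∈ liftLabels q L δ ↔ k.1 ∈ q := by
  simp only [liftLabels, mem_ofPred_eq]
  tauto

/-- The partially evaluated label with all coordinates free. -/
def freeLabel [∀ k, Nonempty (C k)] (ι : Type) (k : K) : PartialLabel C ι :=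
  ⟨k, fun _ => none, Classical.arbitrary _, rfl⟩

theorem card_freeCoord_freeLabel [∀ k, Nonempty (C k)] (k : K) :
    Nat.card (FreeCoord C ι (freeLabel ι k)) = Nat.card (C k) :=
  Nat.card_congr (Equiv.subtypeUnivEquiv fun _ => rfl)

variable [Finite K] [∀ k, Finite (C k)] [∀ k, Nonempty (C k)]

/-- A label with `e` free coordinates is either wholly free, where the lift is `L`, or has more than
`e` coordinates, where `L` agrees with `q`. Hence `degreePart C L e` determines the new leading
part; were it that of `c`, the two lifts would agree in degree `e`. -/
theorem leadingParts_focusFamily_subset {𝓛 : Set (Set K)} {q c : Set K} {m : ℕ}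
    (hcm : DiffAt C c q m) (hmin : ∀ L ∈ 𝓛, ∀ e, DiffAt C L q e → m ≤ e)
    {e : ℕ} (he : m ≤ e) :
    leadingParts (FreeCoord C ι) (focusFamily C 𝓛 q ι) (liftLabels q c ∅) e ⊆
      (fun A => {k : PartialLabel C ι | Nat.card (FreeCoord C ι k) = e ∧
        ((Nat.card (C k.1) = e ∧ k.1 ∈ A) ∨ (Nat.card (C k.1) ≠ e ∧ k.1 ∈ q))}) ''
        (leadingParts C 𝓛 q e \ {degreePart C c e}) := by
  rintro _ ⟨_, ⟨⟨L, hL, hLq, δ, rfl⟩, hdiff⟩, rfl⟩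
  obtain ⟨e', he'⟩ := exists_diffAt (C := C) hLq
  have hme' := hmin L hL e' he'
  have agree {k : PartialLabel C ι} (hk : e' < Nat.card (C k.1)) :
      k ∈ liftLabels q L δ ↔ k ∈ liftLabels q c ∅ := by
    rw [mem_liftLabels_of_iff (he'.1 _ hk), mem_liftLabels_of_iff (hcm.1 _ (by omega))]
  have hee' : e ≤ e' := hdiff.le fun k hk => agree (hk.trans_le (card_freeCoord_le k))
  have hee : e' = e := by
    refine le_antisymm ?_ hee'
    by_contra hlt
    obtain ⟨k, hk, hkL⟩ := he'.2
    have := hdiff.1 (freeLabel ι k) (by rw [card_freeCoord_freeLabel]; omega)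
    rw [mem_liftLabels_of_free fun _ => rfl, mem_liftLabels_of_free fun _ => rfl] at this
    exact hkL (this.trans (hcm.1 k (by omega)))
  subst hee
  refine ⟨degreePart C L e', ⟨⟨L, ⟨hL, he'⟩, rfl⟩, fun hLc => ?_⟩, ?_⟩
  · obtain ⟨k, hk, hkL⟩ := hdiff.2
    have hle := card_freeCoord_le k
    rcases hle.lt_or_eq with hlt | heq
    · exact hkL (agree (by omega))
    · rw [mem_liftLabels_of_free (eq_none_of_card_eq heq),
        mem_liftLabels_of_free (eq_none_of_card_eq heq)] at hkL
      have := Set.ext_iff.1 (mem_singleton_iff.1 hLc) k.1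
      simp only [degreePart, mem_ofPred_eq] at this
      exact hkL (by simpa [← heq, hk] using this)
  · ext k
    simp only [degreePart, mem_ofPred_eq]
    rw [and_comm (a := k ∈ liftLabels q L δ)]
    refine and_congr_right fun hk => ?_
    have hle := card_freeCoord_le k
    rcases hle.lt_or_eq with hlt | heq
    · rw [mem_liftLabels_of_iff (he'.1 _ (by omega))]
      have : Nat.card (C k.1) ≠ e' := by omega
      simp [this]
    · rw [mem_liftLabels_of_free (eq_none_of_card_eq heq)]
      simp [← heq, hk]

end Weight

/-! ### Lexicographic induction -/

theorem isRamsey_of_subset_singleton {K : Type} {C : K → Type} {𝓛 : Set (Set K)} {q : Set K}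
    (h : ∀ L ∈ 𝓛, L = q) : IsRamsey C 𝓛 := fun _ _ =>
  ⟨Unit, inferInstance, fun _ => ⟨∅, univ, univ_nonempty, fun L hL L' hL' => by
    rw [h L hL, h L' hL']⟩⟩

/-- Induction on the numbers `w e` of leading parts of degree `e`, the higher degrees first. -/
theorem isRamsey_of_ncard_leadingParts_le (d : ℕ) (w : Fin (d + 1) → ℕ) :
    ∀ (K : Type) (C : K → Type) [Finite K] [∀ k, Finite (C k)] [∀ k, Nonempty (C k)]
      (𝓛 : Set (Set K)) (q : Set K), (∀ k, Nat.card (C k) ≤ d) →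
      (∀ e : Fin (d + 1), (leadingParts C 𝓛 q e).ncard ≤ w e) → IsRamsey C 𝓛 := by
  induction w using (Pi.Lex.wellFounded (ι := Fin (d + 1)) (α := fun _ => ℕ) (· > ·)
    (s := fun _ => (· < ·)) fun _ => wellFounded_lt).induction with
  | _ w ih =>
  intro K C _ _ _ 𝓛 q hd hw
  classical
  by_cases hq : ∀ L ∈ 𝓛, L = q
  · exact isRamsey_of_subset_singleton hq
  push Not at hq
  have hex : ∃ e, ∃ L ∈ 𝓛, DiffAt C L q e := by
    obtain ⟨L, hL, hLq⟩ := hq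
    obtain ⟨e, he⟩ := exists_diffAt (C := C) hLq
    exact ⟨e, L, hL, he⟩
  obtain ⟨c, hc, hcm⟩ := Nat.find_spec hex
  have hmin : ∀ L ∈ 𝓛, ∀ e, DiffAt C L q e → Nat.find hex ≤ e :=
    fun L hL e he => Nat.find_min' hex ⟨L, hL, he⟩
  generalize Nat.find hex = m at hcm hmin
  have hmd : m < d + 1 := by
    obtain ⟨k, hk, -⟩ := hcm.2
    have := hd k
    omega
  refine isRamsey_of_focusFamily hc hcm.ne fun ι _ => ?_
  have hle (e : ℕ) (he : m ≤ e) :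
      (leadingParts (FreeCoord C ι) (focusFamily C 𝓛 q ι) (liftLabels q c ∅) e).ncard ≤
        (leadingParts C 𝓛 q e \ {degreePart C c e}).ncard :=
    (ncard_le_ncard (leadingParts_focusFamily_subset hcm hmin he) (toFinite _)).trans
      (ncard_image_le (toFinite _))
  have hne : ∀ k : PartialLabel C ι, Nonempty (FreeCoord C ι k) := fun k =>
    let ⟨c, hc⟩ := k.2.2
    ⟨⟨c, hc⟩⟩
  -- Below degree `m` the actual counts serve as weights, since no bound is needed there.
  refine ih (fun e => if m < e then w e else
    (leadingParts (FreeCoord C ι) (focusFamily C 𝓛 q ι) (liftLabels q c ∅) e).ncard)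
    ⟨⟨m, hmd⟩, fun e he => if_pos he, ?_⟩ (PartialLabel C ι) (FreeCoord C ι) _
    (liftLabels q c ∅) (fun k => (card_freeCoord_le k).trans (hd _)) fun e => ?_
  · have hlt : (leadingParts C 𝓛 q m \ {degreePart C c m}).ncard <
        (leadingParts C 𝓛 q m).ncard :=
      ncard_sdiff_singleton_lt_of_mem ⟨c, ⟨hc, hcm⟩, rfl⟩ (toFinite _)
    simpa using ((hle m le_rfl).trans_lt hlt).trans_le (hw ⟨m, hmd⟩)
  · split_ifs with he
    · exact (hle e he.le).trans ((ncard_le_ncard sdiff_subset (toFinite _)).trans (hw e))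
    · exact le_rfl

/-- The **polynomial Hales-Jewett theorem** for arbitrary families of label sets. -/
theorem isRamsey {K : Type} (C : K → Type) [Finite K] [∀ k, Finite (C k)] [∀ k, Nonempty (C k)]
    (𝓛 : Set (Set K)) : IsRamsey C 𝓛 := by
  obtain ⟨d, hd⟩ := (finite_range fun k => Nat.card (C k)).bddAbove
  exact isRamsey_of_ncard_leadingParts_le d _ K C 𝓛 ∅ (fun k => hd (mem_range_self k))
    fun e => le_rfl

end PolyHalesJewett

/-! ### Transfer to `Fin N` -/

open PolyHalesJewett in
theorem mainTheorem1 (r d q : ℕ) (hr : 1 ≤ r) (hd : 1 ≤ d) (hq : 1 ≤ q) :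
    ∃ N : ℕ, 1 ≤ N ∧ ∀ χ : Finset (PHJSpace N d q) → Fin r,
      ∃ (a : Finset (PHJSpace N d q)) (γ : Finset (Fin N)),
        γ.Nonempty ∧
        a ∩ (cartesianPower d γ ×ˢ (Finset.univ : Finset (Fin q))) = ∅ ∧
        ∀ i : Fin q, χ (a ∪ (cartesianPower d γ ×ˢ {i})) = χ a := by
  classical
  have : Nonempty (Fin d) := ⟨⟨0, hd⟩⟩
  obtain ⟨ι, _, H⟩ := isRamsey (fun _ : Fin q => Fin d) Set.univ (Fin r)
  have hι : Nonempty ι := by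
    obtain ⟨-, γ, ⟨x, -⟩, -⟩ := H fun _ => ⟨0, hr⟩
    exact ⟨x⟩
  let φ : ι ≃ Fin (Nat.card ι) := Finite.equivFin ι
  refine ⟨Nat.card ι, Nat.card_pos, fun χ => ?_⟩
  let F (A : Set (Point (fun _ : Fin q => Fin d) ι)) : Finset (PHJSpace (Nat.card ι) d q) :=
    Finset.univ.filter fun v => (⟨v.2, fun c => φ.symm (v.1 c)⟩ : Point _ ι) ∈ A
  obtain ⟨a, γ, hγ, ha⟩ := H fun A => χ (F A)
  let γ' : Finset (Fin (Nat.card ι)) := Finset.univ.filter fun x => φ.symm x ∈ γ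
  -- The label set `∅` clears the trace, giving disjointness; `{i}` then adds the `i`-th copy of the
  -- power.
  refine ⟨F (override a γ ∅), γ', ?_, ?_, fun i => ?_⟩
  · obtain ⟨x, hx⟩ := hγ
    exact ⟨φ x, by simpa [γ'] using hx⟩
  · ext v
    simp [F, γ', cartesianPower, override]
    tauto
  · have : F (override a γ ∅) ∪ cartesianPower d γ' ×ˢ {i} = F (override a γ {i}) := by
      ext ⟨v, j⟩
      simp [F, γ', cartesianPower, override, -Finset.product_singleton, Finset.mem_product]
      tauto
    rw [this]
    exact ha _ (Set.mem_univ _) _ (Set.mem_univ _)
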